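/- For a finite group $G$ and a finite-dimensional complex vector space $V$ on which $G$ acts by linear transformations, let $\beta_{\mathrm{sep}}(G,V)$ be the minimal positive integer $d$ such that for any $v,w\in V$ with different $G$-orbits there is a homogeneous polynomial function $f\colon V\to\mathbb{C}$ of degree at most $d$ that is constant on $G$-orbits and satisfies $f(v)\neq f(w)$. The separating Noether number of $G$ is $\beta_{\mathrm{sep}}(G)=\sup_V\beta_{\mathrm{sep}}(G,V)$, where $V$ ranges over all finite-dimensional complex representations of $G$. Write $C_m$ for the cyclic group of order $m$. Theorem. Let $s\ge 1$ and let $n_1,\dots,n_{2s-1}\geq 2$ be integers such that $n_{i+1}\mid n_i$ for $1\le i\le 2s-2$ and $n_1=n_2=\dots=n_s$. Then $$\beta_{\mathrm{sep}}(C_{n_1}\oplus C_{n_2}\oplus\dots\oplus C_{n_{2s-1}})=s\,n_1.$$ -/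

import Mathlib

namespace SepNoether

/-- `f : V → ℂ` is a homogeneous polynomial function of degree `k` on the complex vector space `V`:
it is given by a homogeneous polynomial of degree `k` in linear functionals on `V`. (For
finite-dimensional `V`, expanding functionals in the coordinate functionals of a basis, this says
that `f` is a homogeneous polynomial of degree `k` in the coordinates; as usual, the zero function
is homogeneous of every degree.) -/
def IsHomogeneousPolyFun {V : Type*} [AddCommGroup V] [Module ℂ V] (f : V → ℂ) (k : ℕ) : Prop :=
  ∃ p : MvPolynomial (Module.Dual ℂ V) ℂ,
    p.IsHomogeneous k ∧ ∀ v : V, f v = MvPolynomial.eval (fun φ : Module.Dual ℂ V => φ v) p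

/-- `f` is constant on the orbits of the group action given by the representation `ρ`. -/
def IsInvariant {G V : Type*} [Group G] [AddCommGroup V] [Module ℂ V]
    (ρ : Representation ℂ G V) (f : V → ℂ) : Prop :=
  ∀ (g : G) (v : V), f (ρ g v) = f v

/-- Any `v, w` with different `G`-orbits are separated by a homogeneous polynomial invariant
of degree at most `d`. -/
def SeparatesOrbits {G V : Type*} [Group G] [AddCommGroup V] [Module ℂ V]
    (ρ : Representation ℂ G V) (d : ℕ) : Prop :=
  ∀ v w : V, (¬ ∃ g : G, ρ g v = w) →
    ∃ (k : ℕ) (f : V → ℂ), k ≤ d ∧ IsHomogeneousPolyFun f k ∧ IsInvariant ρ f ∧ f v ≠ f w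

/-- `β_sep(G, V)`: the minimal positive integer `d` such that homogeneous invariants of degree at
most `d` separate the orbits (`⊤` if there were no such `d`). -/
noncomputable def betaSepRep {G V : Type*} [Group G] [AddCommGroup V] [Module ℂ V]
    (ρ : Representation ℂ G V) : ℕ∞ :=
  ⨅ (d : ℕ) (_ : 0 < d ∧ SeparatesOrbits ρ d), (d : ℕ∞)

/-- The separating Noether number `β_sep(G)`: the supremum of `β_sep(G, V)` over all
finite-dimensional complex representations `V` of `G`. (Every such representation is isomorphic to
one on a space in the lowest universe.) -/
noncomputable def betaSep (G : Type*) [Group G] : ℕ∞ :=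
  ⨆ (V : Type) (_ : AddCommGroup V) (_ : Module ℂ V) (_ : FiniteDimensional ℂ V)
    (ρ : Representation ℂ G V), betaSepRep ρ

end SepNoether

namespace SepNoether

/-! Write `n = n₁`. For the upper bound, let `v`, `w` agree on all invariants of degree at most `s
n`. In coordinates on which `G` acts by characters `χᵢ`, the ratios `cᵢ = wᵢ / vᵢ` of nonzero
coordinates respect every nonnegative relation of that degree among the `χᵢ`. These generate all
relations (`relation_mem_of_small_degree`): as the dual group has rank at most `2s - 1`, relations
on at most `2s` characters suffice, and such a relation reduced mod `n` and its complement to `n`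
have total degree at most `2 s n`. By duality `c` is then evaluation at some `g`, so `w = g v`
(`separatesOrbits_of_rank_le`).

For the lower bound (`le_betaSep_of_dual_families`), take `2s` characters `αᵢ βᵢ` and `αᵢ`, with `s`
independent `αᵢ` of order `n` and `∏ βᵢ = 1` the only constraint on the `βᵢ`. Changing one
coordinate of the all-ones point by a root of unity is not detected below degree `s n`. -/

/-! ### Integer relations in abelian groups of bounded rank. -/

/-- More than `r` elements of an abelian group generated by `r` elements satisfy
an integer relation with coprime coefficients. -/
theorem exists_primitive_relation {A ι : Type*} [AddCommGroup A] {r : ℕ}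
    (π : (Fin r → ℤ) →+ A) (hπ : Function.Surjective π) (x : ι → A) (S : Finset ι)
    (hS : r < S.card) :
    ∃ a : ι → ℤ, (∀ i ∉ S, a i = 0) ∧ S.gcd a = 1 ∧ ∑ i ∈ S, a i • x i = 0 := by
  classical
  choose y hy using fun i => hπ (x i)
  have hdep : ¬ LinearIndependent ℤ (fun i : S => y i) := by
    intro h
    have := h.fintype_card_le_finrank
    simp at this
    omega
  obtain ⟨g, hg, i₀, hi₀⟩ := Fintype.not_linearIndependent_iff.mp hdep
  let f : ι → ℤ := fun i => if h : i ∈ S then g ⟨i, h⟩ else 0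
  have hf : ∑ i ∈ S, f i • y i = 0 := by
    rw [← Finset.sum_coe_sort S, ← hg]
    exact Finset.sum_congr rfl fun i _ => by simp [f]
  -- The gcd can be cancelled because the relation holds between lifts to the torsion-free group
  -- `ℤ^r`.
  obtain ⟨b, hb, hb1⟩ := S.extract_gcd f ⟨i₀, i₀.2⟩
  have hd : S.gcd f ≠ 0 := by
    intro h
    have := Finset.gcd_eq_zero_iff.mp h i₀ i₀.2
    simp [f] at this
    exact hi₀ this
  have hby : ∑ i ∈ S, b i • y i = 0 := by
    have : S.gcd f • ∑ i ∈ S, b i • y i = 0 := by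
      rw [Finset.smul_sum, ← hf]
      exact Finset.sum_congr rfl fun i hi => by rw [smul_smul, ← hb i hi]
    exact (smul_eq_zero.mp this).resolve_left hd
  refine ⟨fun i => if i ∈ S then b i else 0, fun i hi => by simp [hi], ?_, ?_⟩
  · rw [← hb1]
    exact Finset.gcd_congr rfl fun i hi => by simp [hi]
  · have := congrArg π hby
    rw [map_sum, map_zero] at this
    rw [← this]
    exact Finset.sum_congr rfl fun i hi => by simp only [hi, if_true, map_zsmul, hy]

/-- The relations between elements of an abelian group generated by `r` elements are generated
by the relations involving at most `r + 1` of the elements. -/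
theorem relation_mem_of_small_support {A ι : Type*} [AddCommGroup A] [Fintype ι] {r : ℕ}
    (π : (Fin r → ℤ) →+ A) (hπ : Function.Surjective π) (x : ι → A) (H : AddSubgroup (ι → ℤ))
    (hH : ∀ m : ι → ℤ, ∑ i, m i • x i = 0 →
      (Finset.univ.filter fun i => m i ≠ 0).card ≤ r + 1 → m ∈ H)
    (m : ι → ℤ) (hm : ∑ i, m i • x i = 0) : m ∈ H := by
  classical
  induction hk : (Finset.univ.filter fun i => m i ≠ 0).card using Nat.strong_induction_on
    generalizing m with
  | _ k ih =>
  by_cases hle : (Finset.univ.filter fun i => m i ≠ 0).card ≤ r + 1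
  · exact hH m hm hle
  obtain ⟨S, hSsub, hScard⟩ := Finset.exists_subset_card_eq (Nat.le_of_not_le hle)
  obtain ⟨a, ha0, ha1, hax⟩ := exists_primitive_relation π hπ x S (by omega)
  have hax' : ∑ i, a i • x i = 0 := by
    rw [← hax]
    exact (Finset.sum_subset (Finset.subset_univ S) fun i _ hi => by simp [ha0 i hi]).symm
  have haH : a ∈ H := by
    refine hH a hax' ?_
    rw [← hScard]
    refine Finset.card_le_card fun i hi => ?_
    by_contra h
    exact (Finset.mem_filter.mp hi).2 (ha0 i h)
  -- Subtracting `m i • a` kills coordinate `i` and creates no new support, since `S` lies in the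
  -- support of `m`.
  have hmul : ∀ i ∈ S, a i • m ∈ H := by
    intro i hi
    have hmi : m i ≠ 0 := (Finset.mem_filter.mp (hSsub hi)).2
    have key : a i • m - m i • a ∈ H := by
      refine ih _ ?_ (a i • m - m i • a) ?_ rfl
      · rw [← hk]
        refine Finset.card_lt_card (Finset.ssubset_iff_of_subset ?_ |>.mpr ⟨i, ?_, ?_⟩)
        · intro j hj
          simp only [Finset.mem_filter, Finset.mem_univ, true_and, Pi.sub_apply, Pi.smul_apply,
            smul_eq_mul] at hj ⊢
          intro hmj
          have : j ∉ S := fun hjS => (Finset.mem_filter.mp (hSsub hjS)).2 hmj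
          exact hj (by rw [hmj, ha0 j this]; ring)
        · simpa using hmi
        · simp [mul_comm]
      · simp only [Pi.sub_apply, Pi.smul_apply, smul_eq_mul, sub_smul, mul_smul,
          Finset.sum_sub_distrib, ← Finset.smul_sum, hm, hax', smul_zero, sub_zero]
    have := H.add_mem key (H.zsmul_mem haH (m i))
    simpa using this
  -- The integers `t` with `t • m ∈ H` form a subgroup containing every `a i` with `i ∈ S`; these
  -- have gcd 1, so it contains 1.
  obtain ⟨d, hd⟩ := Int.subgroup_cyclic (H.comap ((zmultiplesHom (ι → ℤ)) m))
  have hmem : ∀ t : ℤ, t • m ∈ H ↔ d ∣ t := by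
    intro t
    have : t ∈ H.comap ((zmultiplesHom (ι → ℤ)) m) ↔ d ∣ t := by
      rw [hd, ← AddSubgroup.zmultiples_eq_closure, Int.mem_zmultiples_iff]
    rw [← this, AddSubgroup.mem_comap, zmultiplesHom_apply]
  have : d ∣ S.gcd a := Finset.dvd_gcd fun i hi => (hmem _).mp (hmul i hi)
  rw [ha1] at this
  simpa using (hmem 1).mpr this

/-- Relations between elements of an abelian group of exponent dividing `n` that is generated
by `r` elements are generated by the nonnegative relations of degree at most `d`, as soon as
`n ≤ d` and `n * (r + 1) ≤ 2 * d`. -/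
theorem relation_mem_of_small_degree {A ι : Type*} [AddCommGroup A] [Fintype ι] {r n d : ℕ}
    (hn : 0 < n) (hnd : n ≤ d) (hrd : n * (r + 1) ≤ 2 * d) (hA : ∀ y : A, n • y = 0)
    (π : (Fin r → ℤ) →+ A) (hπ : Function.Surjective π) (x : ι → A) (H : AddSubgroup (ι → ℤ))
    (hH : ∀ m : ι → ℕ, ∑ i, m i • x i = 0 → ∑ i, m i ≤ d → (fun i => (m i : ℤ)) ∈ H)
    (m : ι → ℤ) (hm : ∑ i, m i • x i = 0) : m ∈ H := by
  classical
  have hA' : ∀ y : A, (n : ℤ) • y = 0 := fun y => by simpa using hA y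
  have hnZ : (n : ℤ) ≠ 0 := by exact_mod_cast hn.ne'
  have hsingle : ∀ i : ι, Pi.single i (n : ℤ) ∈ H := by
    intro i
    have := hH (Pi.single i n) (by
      rw [Finset.sum_eq_single i] <;> simp +contextual [hA]) (by simpa using hnd)
    convert this using 1
    ext j
    by_cases h : j = i
    · subst h; simp
    · simp [h]
  have hmul : ∀ z : ι → ℤ, (fun i => (n : ℤ) * z i) ∈ H := by
    intro z
    have : (fun i => (n : ℤ) * z i) = ∑ i, z i • Pi.single i (n : ℤ) := by
      ext j
      simp [Finset.sum_apply, Pi.single_apply, mul_comm]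
    rw [this]
    exact H.sum_mem fun i _ => H.zsmul_mem (hsingle i) _
  refine relation_mem_of_small_support π hπ x H (fun m hm hcard => ?_) m hm
  set u : ι → ℕ := fun i => (m i % n).toNat with hu
  have hu' : ∀ i, (u i : ℤ) = m i % n := fun i => Int.toNat_of_nonneg (Int.emod_nonneg _ hnZ)
  have hun : ∀ i, u i ≤ n := fun i => by
    have := Int.emod_lt_of_pos (m i) (by exact_mod_cast hn : (0 : ℤ) < n)
    have := hu' i
    omega
  have hux : ∑ i, u i • x i = 0 := by
    rw [← hm]
    refine Finset.sum_congr rfl fun i _ => ?_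
    rw [← natCast_zsmul, hu', Int.emod_def, sub_smul, mul_comm, mul_smul, hA', smul_zero, sub_zero]
  set T := Finset.univ.filter fun i => m i ≠ 0 with hT
  have hu0 : ∀ i, i ∉ T → u i = 0 := by
    intro i hi
    have : m i = 0 := by simpa [hT] using hi
    simp [hu, this]
  -- The complement `n - u` on `T` is again a relation. The two degrees add up to `n * T.card ≤ 2 *
  -- d`, so one of them is at most `d`.
  set u' : ι → ℕ := fun i => if i ∈ T then n - u i else 0 with hudef
  have hsum : ∀ i, u i + u' i = if i ∈ T then n else 0 := by
    intro i
    by_cases hi : i ∈ T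
    · simp [hudef, hi, hun i]
    · simp [hudef, hi, hu0 i hi]
  have hu'x : ∑ i, u' i • x i = 0 := by
    have : ∑ i, u i • x i + ∑ i, u' i • x i = 0 := by
      rw [← Finset.sum_add_distrib]
      refine Finset.sum_eq_zero fun i _ => ?_
      rw [← add_smul, hsum]
      split_ifs <;> simp [hA]
    rwa [hux, zero_add] at this
  have htot : ∑ i, u i + ∑ i, u' i ≤ 2 * d := by
    rw [← Finset.sum_add_distrib, Finset.sum_congr rfl fun i _ => hsum i]
    simp only [Finset.sum_ite_mem, Finset.univ_inter, Finset.sum_const, smul_eq_mul]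
    calc T.card * n ≤ (r + 1) * n := Nat.mul_le_mul_right _ hcard
      _ = n * (r + 1) := mul_comm _ _
      _ ≤ 2 * d := hrd
  have huH : (fun i => (u i : ℤ)) ∈ H := by
    by_cases h : ∑ i, u i ≤ d
    · exact hH u hux h
    · have h' := hH u' hu'x (by omega)
      have := H.sub_mem (hmul fun i => if i ∈ T then 1 else 0) h'
      convert this using 1
      ext i
      have := hsum i
      simp only [Pi.sub_apply]
      split_ifs at this ⊢ <;> push_cast [← this] <;> omega
  have := H.add_mem huH (hmul fun i => m i / n)
  convert this using 1
  ext i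
  simp only [Pi.add_apply, hu']
  exact (Int.emod_add_mul_ediv _ _).symm

/-! ### Duality and eigenfunctionals for finite abelian groups. -/

/-- The homomorphism `m ↦ ∏ i, c i ^ m i`. -/
def prodPowHom {ι M : Type*} [Fintype ι] [CommGroup M] (c : ι → M) :
    Multiplicative (ι → ℤ) →* M where
  toFun m := ∏ i, c i ^ m.toAdd i
  map_one' := by simp
  map_mul' a b := by simp [zpow_add, Finset.prod_mul_distrib]

/-- Prescribed values of characters of a finite abelian group are attained at a common group
element, if they satisfy all multiplicative relations between the characters. -/
theorem exists_forall_apply_eq {G ι : Type*} [CommGroup G] [Finite G] [Fintype ι]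
    (χ : ι → G →* ℂˣ) (c : ι → ℂˣ)
    (h : ∀ m : ι → ℤ, ∏ i, χ i ^ m i = 1 → ∏ i, c i ^ m i = 1) :
    ∃ g : G, ∀ i, χ i g = c i := by
  classical
  have hker : (prodPowHom χ).rangeRestrict.ker ≤ (prodPowHom c).ker := by
    intro m hm
    rw [MonoidHom.ker_rangeRestrict] at hm
    exact h _ hm
  -- `θ` sends `χ i` to `c i` on the subgroup generated by the `χ i`. It extends to the whole dual
  -- group, and biduality turns the extension into an element of `G`.
  let θ := (prodPowHom χ).rangeRestrict.liftOfSurjective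
    (prodPowHom χ).rangeRestrict_surjective ⟨prodPowHom c, hker⟩
  have hθ : ∀ m, θ ((prodPowHom χ).rangeRestrict m) = prodPowHom c m := fun m =>
    MonoidHom.liftOfRightInverse_comp_apply _ _ _ ⟨prodPowHom c, hker⟩ m
  have : HasEnoughRootsOfUnity ℂ (Monoid.exponent (G →* ℂˣ)) := by
    rw [Monoid.exponent_eq_of_mulEquiv
      (CommGroup.monoidHom_mulEquiv_of_hasEnoughRootsOfUnity G ℂ).some]
    infer_instance
  obtain ⟨η, hη⟩ := MonoidHom.domRestrict_surjective ℂ (prodPowHom χ).range θ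
  refine ⟨CommGroup.monoidHomMonoidHomEquiv G ℂ η, fun i => ?_⟩
  rw [CommGroup.apply_monoidHomMonoidHomEquiv]
  have h1 := hθ (.ofAdd (Pi.single i 1))
  rw [← hη] at h1
  have h2 : prodPowHom χ (.ofAdd (Pi.single i 1)) = χ i := by
    simp only [prodPowHom, MonoidHom.coe_mk, OneHom.coe_mk, toAdd_ofAdd]
    rw [Finset.prod_eq_single i] <;> simp +contextual
  have h3 : prodPowHom c (.ofAdd (Pi.single i 1)) = c i := by
    simp only [prodPowHom, MonoidHom.coe_mk, OneHom.coe_mk, toAdd_ofAdd]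
    rw [Finset.prod_eq_single i] <;> simp +contextual
  rw [h3] at h1
  rw [← h1]
  simp [h2]

/-- The sum of the values of all characters at `g ≠ 1` vanishes. -/
theorem sum_characters_eq_zero {G : Type*} [CommGroup G] [Finite G] [Fintype (G →* ℂˣ)]
    {g : G} (hg : g ≠ 1) : ∑ χ : G →* ℂˣ, ((χ g : ℂˣ) : ℂ) = 0 := by
  let e : (G →* ℂˣ) →* ℂ := (Units.coeHom ℂ).comp (MonoidHom.eval g)
  have : e ≠ 1 := by
    intro h
    obtain ⟨φ, hφ⟩ := CommGroup.exists_apply_ne_one_of_hasEnoughRootsOfUnity G ℂ hg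
    exact hφ (Units.ext (by simpa [e] using DFunLike.congr_fun h φ))
  simpa [e] using sum_hom_units_eq_zero e this

/-- The points of a finite-dimensional representation of a finite abelian group are separated by
finitely many linear functionals on which the group acts by characters. -/
theorem exists_separating_eigenfunctionals.{u, v} {G : Type u} {V : Type v} [CommGroup G] [Finite G]
    [AddCommGroup V] [Module ℂ V] [FiniteDimensional ℂ V] (ρ : Representation ℂ G V) :
    ∃ (ι : Type u) (_ : Fintype ι) (χ : ι → G →* ℂˣ) (L : ι → Module.Dual ℂ V),
      (∀ i g v, L i (ρ g v) = (χ i g : ℂ) * L i v) ∧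
      ∀ v w, (∀ i, L i v = L i w) → v = w := by
  classical
  have := Fintype.ofFinite G
  have : Finite (G →* ℂˣ) := Finite.of_equiv G
    (CommGroup.monoidHom_mulEquiv_of_hasEnoughRootsOfUnity G ℂ).some.symm.toEquiv
  have := Fintype.ofFinite (G →* ℂˣ)
  let b := Module.finBasis ℂ V
  -- Each basis coordinate is projected to its `χ`-isotypic parts; their sum over `χ` is `|G|` times
  -- that coordinate.
  refine ⟨(G →* ℂˣ) × Fin (Module.finrank ℂ V), inferInstance, Prod.fst,
    fun p => ∑ g : G, ((p.1 g⁻¹ : ℂˣ) : ℂ) • (b.coord p.2 ∘ₗ ρ g), ?_, ?_⟩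
  · rintro ⟨χ, j⟩ h v
    simp only [LinearMap.sum_apply, LinearMap.smul_apply, LinearMap.comp_apply, smul_eq_mul,
      Finset.mul_sum]
    refine Fintype.sum_equiv (Equiv.mulRight h) _ _ fun g => ?_
    simp only [Equiv.coe_mulRight, ← Module.End.mul_apply, ← map_mul, ← mul_assoc]
    rw [← Units.val_mul, ← map_mul, mul_inv_rev, mul_inv_cancel_left]
  · intro v w hvw
    refine b.ext_elem fun j => ?_
    have key : ∀ u : V, ∑ χ : G →* ℂˣ, ∑ g : G, ((χ g⁻¹ : ℂˣ) : ℂ) * b.coord j (ρ g u) =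
        Fintype.card (G →* ℂˣ) * b.coord j u := by
      intro u
      rw [Finset.sum_comm]
      simp only [← Finset.sum_mul]
      rw [Finset.sum_eq_single 1]
      · simp
      · intro g _ hg
        rw [sum_characters_eq_zero (inv_ne_one.mpr hg), zero_mul]
      · simp
    have hsum := Finset.sum_congr rfl fun (χ : G →* ℂˣ) (_ : χ ∈ Finset.univ) => hvw (χ, j)
    simp only [LinearMap.sum_apply, LinearMap.smul_apply, LinearMap.comp_apply, smul_eq_mul] at hsum
    rw [key, key] at hsum
    exact mul_left_cancel₀ (Nat.cast_ne_zero.mpr Fintype.card_ne_zero) hsum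

/-- A monomial in linear functionals is a homogeneous polynomial function. -/
theorem isHomogeneousPolyFun_monomial {V ι : Type*} [AddCommGroup V] [Module ℂ V] [Fintype ι]
    (L : ι → Module.Dual ℂ V) (m : ι → ℕ) :
    IsHomogeneousPolyFun (fun v => ∏ i, L i v ^ m i) (∑ i, m i) := by
  refine ⟨∏ i, MvPolynomial.X (L i) ^ m i, ?_, fun v => by simp⟩
  refine MvPolynomial.IsHomogeneous.prod _ _ _ fun i _ => ?_
  simpa using (MvPolynomial.isHomogeneous_X ℂ (L i)).pow (m i)

theorem prod_pow_dite_zero {ι M : Type*} [Fintype ι] [CommMonoid M] {p : ι → Prop}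
    [DecidablePred p] (f : ι → M) (k : Subtype p → ℕ) :
    ∏ i, f i ^ (if h : p i then k ⟨i, h⟩ else 0) = ∏ i : Subtype p, f i ^ k i := by
  refine (Fintype.prod_of_injective _ Subtype.val_injective _ _ (fun i hi => ?_)
    fun i => ?_).symm
  · rw [dif_neg fun h => hi ⟨⟨i, h⟩, rfl⟩, pow_zero]
  · rw [dif_pos i.2]

theorem sum_dite_zero {ι : Type*} [Fintype ι] {p : ι → Prop} [DecidablePred p]
    (k : Subtype p → ℕ) : ∑ i, (if h : p i then k ⟨i, h⟩ else 0) = ∑ i, k i := by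
  refine (Fintype.sum_of_injective _ Subtype.val_injective _ _ (fun i hi => ?_)
    fun i => ?_).symm
  · rw [dif_neg fun h => hi ⟨⟨i, h⟩, rfl⟩]
  · rw [dif_pos i.2]

/-! ### Upper bound. -/

/-- A finite abelian group of rank at most `r` and exponent dividing `n` has all its orbits
separated in degree `d`, as soon as `n ≤ d` and `n * (r + 1) ≤ 2 * d`. -/
theorem separatesOrbits_of_rank_le {G V : Type*} [CommGroup G] [Finite G]
    [AddCommGroup V] [Module ℂ V] [FiniteDimensional ℂ V] (ρ : Representation ℂ G V)
    {r n d : ℕ} (hn : 0 < n) (hnd : n ≤ d) (hrd : n * (r + 1) ≤ 2 * d)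
    (hG : ∀ g : G, g ^ n = 1) (π : (Fin r → ℤ) →+ Additive G) (hπ : Function.Surjective π) :
    SeparatesOrbits ρ d := by
  classical
  intro v w hvw
  by_contra hcon
  obtain ⟨ι, _, χ, L, hL, hsep⟩ := exists_separating_eigenfunctionals ρ
  have hagree : ∀ m : ι → ℕ, ∏ i, χ i ^ m i = 1 → ∑ i, m i ≤ d →
      ∏ i, L i v ^ m i = ∏ i, L i w ^ m i := by
    intro m hm hmd
    by_contra hne
    refine hcon ⟨_, _, hmd, isHomogeneousPolyFun_monomial L m, fun g u => ?_, hne⟩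
    have : ∏ i, ((χ i g : ℂˣ) : ℂ) ^ m i = 1 := by
      have := congrArg (fun ψ : G →* ℂˣ => ((ψ g : ℂˣ) : ℂ)) hm
      simpa [MonoidHom.finsetProd_apply] using this
    simp only [hL, mul_pow, Finset.prod_mul_distrib, this, one_mul]
  have hχn : ∀ φ : G →* ℂˣ, φ ^ n = 1 := fun φ => by
    ext g
    simp [← map_pow, hG]
  -- The invariant `L i ^ n` has degree `n ≤ d`, so `v` and `w` have the same vanishing coordinates.
  have hzero : ∀ i, L i v = 0 ↔ L i w = 0 := by
    intro i
    have := hagree (Pi.single i n) (by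
      rw [Finset.prod_eq_single i (fun j _ hj => by rw [Pi.single_eq_of_ne hj]; exact pow_zero (χ j))
        (by simp), Pi.single_eq_same, hχn]) (by simpa using hnd)
    rw [Finset.prod_eq_single i (by simp +contextual) (by simp),
      Finset.prod_eq_single i (by simp +contextual) (by simp)] at this
    simp only [Pi.single_eq_same] at this
    rw [← pow_eq_zero_iff hn.ne', this, pow_eq_zero_iff hn.ne']
  let J := {i : ι // L i v ≠ 0}
  have hJw : ∀ i : J, L i w ≠ 0 := fun i => mt (hzero i).mpr i.2
  let c : J → ℂˣ := fun i => Units.mk0 (L i w / L i v) (div_ne_zero (hJw i) i.2)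
  let e := (CommGroup.monoidHom_mulEquiv_of_hasEnoughRootsOfUnity G ℂ).some
  let π' : (Fin r → ℤ) →+ Additive (G →* ℂˣ) :=
    (MulEquiv.toAdditive e.symm).toAddMonoidHom.comp π
  have hπ' : Function.Surjective π' := (MulEquiv.toAdditive e.symm).surjective.comp hπ
  have hrel : ∀ m : J → ℤ, ∏ i : J, χ i ^ m i = 1 → ∏ i, c i ^ m i = 1 := by
    intro m hm
    refine relation_mem_of_small_degree (A := Additive (G →* ℂˣ)) hn hnd hrd
      (fun y => hχn y.toMul) π' hπ' (fun i : J => Additive.ofMul (χ i))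
      (MonoidHom.toAdditiveRight (prodPowHom c)).ker ?_ m ?_
    · intro k hk hkd
      have hk' : ∏ i : J, χ i ^ k i = 1 := hk
      let k' : ι → ℕ := fun i => if h : L i v ≠ 0 then k ⟨i, h⟩ else 0
      have hmon := hagree k' ((prod_pow_dite_zero (fun i => χ i) k).trans hk')
        ((sum_dite_zero k).trans_le hkd)
      rw [prod_pow_dite_zero (fun i => L i v) k, prod_pow_dite_zero (fun i => L i w) k] at hmon
      change ∏ i : J, c i ^ (k i : ℤ) = 1
      ext
      simp only [c, zpow_natCast, Units.coe_prod, Units.val_pow_eq_pow_val, Units.val_mk0, div_pow,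
        Finset.prod_div_distrib, Units.val_one]
      rw [← hmon, div_self]
      exact Finset.prod_ne_zero_iff.mpr fun i _ => pow_ne_zero _ i.2
    · exact hm
  obtain ⟨g, hg⟩ := exists_forall_apply_eq (fun i : J => χ i) c hrel
  refine hvw ⟨g, hsep _ _ fun i => ?_⟩
  rw [hL]
  by_cases hi : L i v = 0
  · rw [hi, (hzero i).mp hi, mul_zero]
  · have := hg ⟨i, hi⟩
    simp only at this
    rw [this]
    simp [c, hi]

/-! ### Lower bound via diagonal representations. -/

/-- The diagonal representation with characters `χ i`. -/
noncomputable def diagRep {G ι : Type*} [CommGroup G] (χ : ι → G →* ℂˣ) :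
    Representation ℂ G (ι → ℂ) where
  toFun g := LinearMap.pi fun i => ((χ i g : ℂˣ) : ℂ) • LinearMap.proj i
  map_one' := by ext; simp
  map_mul' g h := by
    refine LinearMap.ext fun v => funext fun i => ?_
    simp [mul_assoc]

theorem diagRep_apply {G ι : Type*} [CommGroup G] (χ : ι → G →* ℂˣ) (g : G) (v : ι → ℂ) (i : ι) :
    diagRep χ g v i = (χ i g : ℂ) * v i := by
  simp [diagRep]

/-- A homogeneous polynomial function on `ι → ℂ` is given by a homogeneous polynomial in the
coordinates. -/
theorem IsHomogeneousPolyFun.exists_coordinates {ι : Type*} [Fintype ι] {f : (ι → ℂ) → ℂ} {k : ℕ}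
    (hf : IsHomogeneousPolyFun f k) :
    ∃ P : MvPolynomial ι ℂ, P.IsHomogeneous k ∧ ∀ v, f v = MvPolynomial.eval v P := by
  classical
  obtain ⟨p, hp, hfp⟩ := hf
  let q : Module.Dual ℂ (ι → ℂ) → MvPolynomial ι ℂ := fun φ =>
    ∑ i, MvPolynomial.C (φ (Pi.single i 1)) * MvPolynomial.X i
  refine ⟨MvPolynomial.aeval q p, ?_, fun v => ?_⟩
  · have := hp.aeval q (n := 1) fun φ =>
      MvPolynomial.IsHomogeneous.sum _ _ _ fun i _ => by
        simpa using (MvPolynomial.isHomogeneous_C ι _).mul (MvPolynomial.isHomogeneous_X ℂ i)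
    rwa [one_mul] at this
  · rw [hfp]
    have hq : (fun φ : Module.Dual ℂ (ι → ℂ) => φ v) = fun φ => MvPolynomial.eval v (q φ) := by
      ext φ
      conv_lhs => rw [LinearMap.pi_apply_eq_sum_univ φ v]
      simp only [q, map_sum, map_mul, MvPolynomial.eval_C, MvPolynomial.eval_X, smul_eq_mul]
      refine Finset.sum_congr rfl fun i _ => ?_
      rw [mul_comm]
      congr 2
      ext j
      simp [Pi.single_apply, eq_comm]
    rw [hq]
    have : (MvPolynomial.eval v).comp (MvPolynomial.aeval q).toRingHom =
        MvPolynomial.eval fun φ => MvPolynomial.eval v (q φ) := by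
      apply MvPolynomial.ringHom_ext <;> simp
    exact (DFunLike.congr_fun this p).symm

/-- Homogeneous invariants of a diagonal representation do not separate two points at which all
invariant monomials of the same degree agree. -/
theorem apply_eq_of_invariant_monomials_eq {G ι : Type*} [CommGroup G] [Finite G] [Fintype ι]
    (χ : ι → G →* ℂˣ) {f : (ι → ℂ) → ℂ} {k : ℕ} (hf : IsHomogeneousPolyFun f k)
    (hinv : IsInvariant (diagRep χ) f) (v w : ι → ℂ)
    (hvw : ∀ m : ι → ℕ, (∀ g, ∏ i, χ i g ^ m i = 1) → ∑ i, m i = k →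
      ∏ i, v i ^ m i = ∏ i, w i ^ m i) :
    f v = f w := by
  classical
  have := Fintype.ofFinite G
  obtain ⟨P, hP, hfP⟩ := hf.exists_coordinates
  let ψ : (ι →₀ ℕ) → G →* ℂˣ := fun m => ∏ i, χ i ^ m i
  -- Averaging over `G` kills exactly the monomials of `P` with nontrivial character.
  have havg : ∀ x, (Fintype.card G : ℂ) * f x =
      ∑ m ∈ P.support, P.coeff m * (∑ g, ((ψ m g : ℂˣ) : ℂ)) * ∏ i, x i ^ m i := by
    intro x
    calc (Fintype.card G : ℂ) * f x = ∑ g : G, f (diagRep χ g x) := by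
          simp [hinv _ x]
      _ = ∑ g : G, ∑ m ∈ P.support, P.coeff m * ((ψ m g : ℂˣ) : ℂ) * ∏ i, x i ^ m i := by
          refine Finset.sum_congr rfl fun g _ => ?_
          rw [hfP, MvPolynomial.eval_eq']
          refine Finset.sum_congr rfl fun m _ => ?_
          simp only [diagRep_apply, mul_pow, Finset.prod_mul_distrib, ψ,
            MonoidHom.finsetProd_apply, MonoidHom.pow_apply, Units.coe_prod,
            Units.val_pow_eq_pow_val, mul_assoc]
      _ = _ := by
          rw [Finset.sum_comm]
          simp only [Finset.mul_sum, Finset.sum_mul]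
  have hcard : (Fintype.card G : ℂ) ≠ 0 := Nat.cast_ne_zero.mpr Fintype.card_ne_zero
  refine mul_left_cancel₀ hcard ?_
  rw [havg, havg]
  refine Finset.sum_congr rfl fun m hm => ?_
  by_cases hψ : ψ m = 1
  · congr 1
    refine hvw m (fun g => ?_) ?_
    · have := DFunLike.congr_fun hψ g
      simpa [ψ, MonoidHom.finsetProd_apply] using this
    · have := hP (MvPolynomial.mem_support_iff.mp hm)
      rw [← this, Finsupp.weight_apply, Finsupp.sum_fintype] <;> simp
  · have : ∑ g, ((ψ m g : ℂˣ) : ℂ) = 0 :=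
      sum_hom_units_eq_zero ((Units.coeHom ℂ).comp (ψ m)) fun h => hψ <| by
        ext g
        simpa using DFunLike.congr_fun h g
    simp [this]

/-- A criterion for lower bounds of the separating Noether number, in terms of characters `χ i`
and prescribed values `c i`. -/
theorem le_betaSep {G : Type*} {ι : Type} [CommGroup G] [Finite G] [Fintype ι]
    (χ : ι → G →* ℂˣ) (c : ι → ℂ) (d : ℕ) (hc : ¬ ∃ g, ∀ i, (χ i g : ℂ) = c i)
    (hd : ∀ m : ι → ℕ, (∀ g, ∏ i, χ i g ^ m i = 1) → ∑ i, m i < d → ∏ i, c i ^ m i = 1) :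
    (d : ℕ∞) ≤ betaSep G := by
  refine le_trans ?_ (le_iSup_of_le (ι → ℂ) <| le_iSup_of_le inferInstance <|
    le_iSup_of_le inferInstance <| le_iSup_of_le inferInstance <| le_iSup_of_le (diagRep χ) le_rfl)
  refine le_iInf₂ fun e he => ?_
  rw [Nat.cast_le]
  by_contra! hlt
  obtain ⟨k, f, hk, hf, hinv, hne⟩ := he.2 (fun _ => 1) c (by
    rintro ⟨g, hg⟩
    exact hc ⟨g, fun i => by rw [← hg, diagRep_apply, mul_one]⟩)
  refine hne (apply_eq_of_invariant_monomials_eq χ hf hinv _ _ fun m hm hmk => ?_)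
  rw [hd m hm (by omega)]
  simp

/-- Lower bound for the separating Noether number of a finite abelian group with characters `α i`
and `β i` dual to elements `a i` of order `n` and `b i` of order a multiple of `q`. -/
theorem le_betaSep_of_dual_families {G : Type*} {ι : Type} [CommGroup G] [Finite G] [Fintype ι]
    {n q : ℕ} (hq : 1 < q) (α : Option ι → G →* ℂˣ) (β : ι → G →* ℂˣ) (a : Option ι → G)
    (b : ι → G) (r : ι → ℕ) (hqr : ∀ i, q ∣ r i)
    (haα : ∀ i, IsPrimitiveRoot (α i (a i)) n) (haα' : ∀ i j, i ≠ j → α i (a j) = 1)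
    (haβ : ∀ i j, β i (a j) = 1) (hbα : ∀ i j, α i (b j) = 1)
    (hbβ : ∀ i, IsPrimitiveRoot (β i (b i)) (r i)) (hbβ' : ∀ i j, i ≠ j → β i (b j) = 1) :
    (((Fintype.card ι + 1) * n : ℕ) : ℕ∞) ≤ betaSep G := by
  classical
  have : NeZero q := ⟨by omega⟩
  obtain ⟨ω, hω⟩ := HasEnoughRootsOfUnity.exists_primitiveRoot ℂ q
  -- The twists by `β` cancel over the first family, so both families have the same product; the
  -- values prescribed below violate this relation.
  let χ : Option ι ⊕ Option ι → G →* ℂˣ := Sum.elim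
    (fun i => i.elim (α none * ∏ j, (β j)⁻¹) fun j => α (some j) * β j) α
  refine le_betaSep χ (fun i => if i = Sum.inl none then ω else 1) _ ?_ ?_
  · rintro ⟨g, hg⟩
    have h1 : ∏ i : Option ι, χ (Sum.inl i) g = ∏ i : Option ι, χ (Sum.inr i) g := by
      simp only [χ, Fintype.prod_option, Sum.elim_inl, Sum.elim_inr, Option.elim, MonoidHom.mul_apply,
        Finset.prod_mul_distrib, MonoidHom.finsetProd_apply, MonoidHom.inv_apply,
        Finset.prod_inv_distrib]
      rw [mul_comm (∏ i, α (some i) g), ← mul_assoc, inv_mul_cancel_right]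
    have h2 := congrArg Units.val h1
    simp only [Units.coe_prod, hg] at h2
    simp only [Fintype.prod_option, Sum.inl.injEq, reduceCtorEq, if_true, if_false,
      Finset.prod_const_one, mul_one] at h2
    exact hω.ne_one hq h2
  · intro m hm hlt
    have hpair : ∀ i, n ∣ m (Sum.inl i) + m (Sum.inr i) := by
      intro i
      rw [← (haα i).pow_eq_one_iff_dvd, ← hm (a i)]
      have hinl : ∀ j, χ (Sum.inl j) (a i) = α j (a i) := by
        rintro (_ | j) <;> simp [χ, haβ, MonoidHom.finsetProd_apply]
      rw [Fintype.prod_sum_type, Finset.prod_eq_single i, Finset.prod_eq_single i, hinl, pow_add]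
      · rfl
      · intro j _ hj
        exact (congrArg (· ^ _) (haα' j i hj)).trans (one_pow _)
      · simp
      · intro j _ hj
        rw [hinl, haα' j i hj, one_pow]
      · simp
    have hcong : ∀ i, (q : ℤ) ∣ m (Sum.inl (some i)) - m (Sum.inl none) := by
      intro i
      refine (Int.natCast_dvd_natCast.mpr (hqr i)).trans ?_
      rw [← (hbβ i).zpow_eq_one_iff_dvd, ← hm (b i), Fintype.prod_sum_type]
      have hinr : ∀ j, χ (Sum.inr j) (b i) = 1 := fun j => hbα j i
      have hnone : χ (Sum.inl none) (b i) = (β i (b i))⁻¹ := by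
        simp only [χ, Sum.elim_inl, Option.elim, MonoidHom.mul_apply, hbα, one_mul,
          MonoidHom.finsetProd_apply, MonoidHom.inv_apply]
        exact Finset.prod_eq_single i (fun j _ hj => by rw [hbβ' j i hj, inv_one]) (by simp)
      have hsome : ∀ j, χ (Sum.inl (some j)) (b i) = β j (b i) := fun j => by
        simp [χ, hbα]
      simp only [hinr, one_pow, Finset.prod_const_one, mul_one, Fintype.prod_option, hnone, hsome]
      rw [Finset.prod_eq_single i (fun j _ hj => by rw [hbβ' j i hj, one_pow]) (by simp),
        zpow_sub, zpow_natCast, zpow_natCast, inv_pow, mul_comm]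
    rw [Finset.prod_eq_single (Sum.inl none) (fun j _ hj => by rw [if_neg hj, one_pow]) (by simp),
      if_pos rfl, hω.pow_eq_one_iff_dvd]
    -- All exponents in the first family agree mod `q`. If one is not divisible by `q`, none
    -- vanishes, so each pair contributes at least `n` to the degree.
    by_contra hndvd
    have hpos : ∀ i, m (Sum.inl i) ≠ 0 := by
      rintro (_ | i) h0
      · exact hndvd (by simp [h0])
      · have := hcong i
        rw [h0, Nat.cast_zero, zero_sub, dvd_neg, Int.natCast_dvd_natCast] at this
        exact hndvd this
    have hge : ∀ i, n ≤ m (Sum.inl i) + m (Sum.inr i) := fun i =>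
      Nat.le_of_dvd (Nat.add_pos_left (Nat.pos_of_ne_zero (hpos i)) _) (hpair i)
    have hsum := Finset.card_nsmul_le_sum (Finset.univ : Finset (Option ι)) _ n fun i _ => hge i
    rw [Finset.sum_add_distrib, ← Fintype.sum_sum_type, smul_eq_mul, Finset.card_univ,
      Fintype.card_option] at hsum
    omega

/-! ### Products of cyclic groups and the main theorem. -/

/-- Coordinate generators of a finite product of cyclic groups and their dual characters. -/
theorem exists_dual_characters {ι : Type*} (N : ι → ℕ) [∀ j, NeZero (N j)] :
    ∃ (ψ : ι → Multiplicative ((i : ι) → ZMod (N i)) →* ℂˣ)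
      (e : ι → Multiplicative ((i : ι) → ZMod (N i))),
      (∀ j, IsPrimitiveRoot (ψ j (e j)) (N j)) ∧ ∀ j k, j ≠ k → ψ j (e k) = 1 := by
  classical
  let ψ : ∀ j, Multiplicative ((i : ι) → ZMod (N i)) →* ℂ := fun j =>
    { toFun := fun g => ZMod.stdAddChar (g.toAdd j)
      map_one' := by simp
      map_mul' := fun g h => by simp [AddChar.map_add_eq_mul] }
  refine ⟨fun j => (ψ j).toHomUnits, fun j => .ofAdd (Pi.single j 1), fun j => ?_,
    fun j k hjk => ?_⟩
  · rw [← IsPrimitiveRoot.coe_units_iff]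
    have h : ψ j (.ofAdd (Pi.single j 1)) = Complex.exp (2 * Real.pi * Complex.I / N j) := by
      have := ZMod.stdAddChar_coe (N := N j) 1
      simpa [ψ] using this
    rw [MonoidHom.coe_toHomUnits, h]
    exact Complex.isPrimitiveRoot_exp _ (NeZero.ne _)
  · ext
    simp [ψ, hjk]

/-- The separating Noether number of a product of at most `r` cyclic groups of order dividing `n`
is at most `d`, as soon as `n ≤ d` and `n * (r + 1) ≤ 2 * d`. -/
theorem betaSep_prod_zmod_le {r n d : ℕ} (N : Fin r → ℕ) [∀ j, NeZero (N j)] (hn : 0 < n)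
    (hN : ∀ j, N j ∣ n) (hnd : n ≤ d) (hrd : n * (r + 1) ≤ 2 * d) :
    betaSep (Multiplicative ((i : Fin r) → ZMod (N i))) ≤ d := by
  refine iSup_le fun V => iSup_le fun _ => iSup_le fun _ => iSup_le fun _ => iSup_le fun ρ =>
    iInf₂_le_of_le d ⟨by omega, ?_⟩ le_rfl
  let π : (Fin r → ℤ) →+ Additive (Multiplicative ((i : Fin r) → ZMod (N i))) :=
    { toFun := fun m => .ofMul (.ofAdd fun i => (m i : ZMod (N i)))
      map_zero' := by ext; simp
      map_add' := fun a b => by ext; simp }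
  refine separatesOrbits_of_rank_le ρ hn hnd hrd (fun g => ?_) π fun y => ?_
  · refine Multiplicative.toAdd.injective (funext fun i => ?_)
    simp [(ZMod.natCast_eq_zero_iff _ _).mpr (hN i)]
  · choose m hm using fun i => ZMod.intCast_surjective (y.toMul.toAdd i)
    exact ⟨m, congrArg (fun z => Additive.ofMul (Multiplicative.ofAdd z)) (funext hm)⟩

end SepNoether

theorem theorem6p1 (s : ℕ) (hs : 1 ≤ s) (n : ℕ → ℕ)
    (hn : ∀ i : ℕ, 1 ≤ i → i ≤ 2 * s - 1 → 2 ≤ n i)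
    (hdvd : ∀ i : ℕ, 1 ≤ i → i + 1 ≤ 2 * s - 1 → n (i + 1) ∣ n i)
    (heq : ∀ i : ℕ, 1 ≤ i → i ≤ s → n i = n 1) :
    SepNoether.betaSep (Multiplicative ((i : Fin (2 * s - 1)) → ZMod (n ((i : ℕ) + 1)))) =
      ((s * n 1 : ℕ) : ℕ∞) := by
  have hchain : ∀ i j, 1 ≤ i → i ≤ j → j ≤ 2 * s - 1 → n j ∣ n i := by
    intro i j hi hij
    induction j, hij using Nat.le_induction with
    | base => exact fun _ => dvd_rfl
    | succ j hij ih => exact fun hj => (hdvd j (by omega) hj).trans (ih (by omega))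
  have hn1 : 2 ≤ n 1 := hn 1 le_rfl (by omega)
  have : ∀ i : Fin (2 * s - 1), NeZero (n ((i : ℕ) + 1)) := fun i =>
    ⟨by have := hn (i + 1) (by omega) (by omega); omega⟩
  refine le_antisymm ?_ ?_
  · refine SepNoether.betaSep_prod_zmod_le (n := n 1) _ (by omega)
      (fun j => hchain 1 _ le_rfl (by omega) (by omega)) (Nat.le_mul_of_pos_left _ hs) ?_
    rw [Nat.sub_add_cancel (by omega)]
    exact le_of_eq (by ring)
  · obtain ⟨ψ, e, hψ, hψ'⟩ := SepNoether.exists_dual_characters fun i : Fin (2 * s - 1) => n ((i : ℕ) + 1)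
    -- Indices are zero-based: `A` covers the first `s` factors, all of order `n 1`, and `B` the
    -- other `s - 1`, whose orders are multiples of `q = n (2 * s - 1)`.
    let A : Option (Fin (s - 1)) → Fin (2 * s - 1) := fun i =>
      i.elim ⟨0, by omega⟩ fun j => ⟨j + 1, by omega⟩
    let B : Fin (s - 1) → Fin (2 * s - 1) := fun i => ⟨s + i, by omega⟩
    have hA : Function.Injective A := by
      rintro (_ | i) (_ | j) h <;> simp [A, Fin.ext_iff] at h ⊢
      exact h
    have hB : Function.Injective B := fun i j h => by simpa [B, Fin.ext_iff] using h
    have hAs : ∀ i, (A i : ℕ) < s := by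
      rintro (_ | i) <;> simp only [A, Option.elim] <;> omega
    have hAB : ∀ i j, A i ≠ B j := fun i j h => by
      have := hAs i
      rw [h] at this
      simp only [B] at this
      omega
    have key := SepNoether.le_betaSep_of_dual_families (n := n 1) (q := n (2 * s - 1))
      (hn _ (by omega) le_rfl) (fun i => ψ (A i)) (fun i => ψ (B i)) (fun i => e (A i))
      (fun i => e (B i)) (fun i => n (B i + 1))
      (fun i => hchain _ _ (by omega) (by omega) le_rfl)
      (fun i => by
        have := hψ (A i)
        rwa [heq _ (by omega) (hAs i)] at this)
      (fun i j hij => hψ' _ _ (hA.ne hij)) (fun i j => hψ' _ _ (hAB j i).symm)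
      (fun i j => hψ' _ _ (hAB i j)) (fun i => hψ _) (fun i j hij => hψ' _ _ (hB.ne hij))
    rwa [Fintype.card_fin, Nat.sub_add_cancel hs] at key
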